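/- Let $H$ be a separable real Hilbert space, let $T\in(0,\infty)$, let $(\Omega,\mathcal F,\mathbb P)$ be a probability space with a normal filtration $(\mathbb F_t)_{t\in[0,T]}$, and let $(W_t)_{t\in[0,T]}$ be an $\mathrm{id}_H$-cylindrical Wiener process with respect to $(\mathbb F_t)_{t\in[0,T]}$. Let $\mathbb H\subseteq H$ be an orthonormal basis of $H$, let $c,p\in(0,\infty)$ and $\delta\in(-\infty,\tfrac12-\tfrac1{2p})$, let $e\colon\mathbb N=\{1,2,\dots\}\to\mathbb H$ be a bijection, and let $\lambda,\mu\colon\mathbb H\to\mathbb R$ satisfy $\lambda_{e_n}=-c\,n^p$ for all $n\in\mathbb N$ and $|\mu_h|=|\lambda_h|^\delta$ for all $h\in\mathbb H$. Let $A$ be the linear operator on $H$ with $D(A)=\{v\in H:\sum_{h\in\mathbb H}|\lambda_h\langle h,v\rangle_H|^2<\infty\}$ and $Av=\sum_{h\in\mathbb H}\lambda_h\langle h,v\rangle_H\,h$. For $r\ge 0$ let $H_r=D((-A)^r)$ with norm $\|(-A)^r\cdot\|_H$, and for $r<0$ let $H_r$ be the completion of $H$ with respect to $\|(-A)^r\cdot\|_H$.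 Let $\mathbf H_0=H_0\times H_{-1/2}$ and $\mathbf H_1=H_{1/2}\times H_0$ be the product Hilbert spaces, and let $\mathbf A\colon \mathbf H_1\subseteq\mathbf H_0\to\mathbf H_0$, $\mathbf A(v,w)=(w,Av)$, where $A$ is extended continuously to $H_{1/2}\to H_{-1/2}$; $(\mathrm e^{t\mathbf A})_{t\ge0}$ denotes the strongly continuous semigroup generated by $\mathbf A$. For $I\subseteq\mathbb H$ let $\mathbf P_I$ be the orthogonal projection of $\mathbf H_0$ onto the closed linear span of $\{(h,0),(0,h):h\in I\}$, let $\mathbf B\colon H\to\mathbf H_0$ be the Hilbert–Schmidt operator $\mathbf Bv=\bigl(0,\sum_{h\in\mathbb H}\mu_h\langle h,v\rangle_H\,h\bigr)$, and let $\mathbf X^I\colon\Omega\to\mathbf H_0$ be a random variable with, $\mathbb P$-almost surely, $$\mathbf X^I=\int_0^T\mathrm e^{(T-s)\mathbf A}\,\mathbf P_I\mathbf B\,\mathrm dW_s .$$ For $N\in\mathbb N$ let $I_N=\{e_1,\dots,e_N\}$. Then for all $N\in\mathbb N$ the random variables $\mathbf X^{\mathbb H}$ and $\mathbf X^{I_N}$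 are square integrable, and $$\mathbb E\bigl[\|\mathbf X^{\mathbb H}\|_{\mathbf H_0}^2\bigr]-\mathbb E\bigl[\|\mathbf X^{I_N}\|_{\mathbf H_0}^2\bigr]\;\ge\;\frac{T\,c^{2\delta-1}\,N^{p(2\delta-1)+1}}{[p(1-2\delta)-1]\,2^{p(1-2\delta)-1}} .$$ -/

import Mathlib

open MeasureTheory ProbabilityTheory Filter Topology
open scoped InnerProductSpace ENNReal

noncomputable section

namespace StochWave

/-! ### Strongly continuous semigroups and their generators -/

/-- `S`, restricted to times `t ≥ 0`, is a strongly continuous semigroup of bounded linear operators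
on `U` whose generator is the operator with graph `G`; that is, `G x y` (read "`x` lies in the
domain and is mapped to `y`") holds if and only if the right derivative at `0` of `t ↦ S t x`
exists and equals `y`. Thus `S t` is `e^{tG}` for `t ≥ 0`. -/
structure IsSemigroupGeneratedBy {U : Type*} [NormedAddCommGroup U] [NormedSpace ℝ U]
    (S : ℝ → U →L[ℝ] U) (G : U → U → Prop) : Prop where
  zero : S 0 = ContinuousLinearMap.id ℝ U
  add : ∀ s t : ℝ, 0 ≤ s → 0 ≤ t → S (s + t) = (S s).comp (S t)
  tendsto : ∀ x : U, Tendsto (fun t => S t x) (𝓝[>] 0) (𝓝 x)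
  generator : ∀ x y : U, G x y ↔ Tendsto (fun t : ℝ => t⁻¹ • (S t x - x)) (𝓝[>] 0) (𝓝 y)

/-! ### Filtrations and cylindrical Wiener processes on `[0, T]` -/

section Wiener

variable {Ω : Type*} {mΩ : MeasurableSpace Ω}
variable {H : Type*} [NormedAddCommGroup H] [InnerProductSpace ℝ H]

/-- Normal filtration on `[0, T]`: the `σ`-algebra at time `0` contains all null sets of the
probability space, and the filtration is right-continuous. -/
structure IsNormalFiltration {T : ℝ} (P : Measure Ω)
    (F : Filtration (Set.Icc (0 : ℝ) T) mΩ) : Prop where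
  null_sets : ∀ (t : Set.Icc (0 : ℝ) T) (A : Set Ω),
    MeasurableSet A → P A = 0 → MeasurableSet[F t] A
  right_cont : ∀ t : Set.Icc (0 : ℝ) T, (t : ℝ) < T → (⨅ s, ⨅ (_ : t < s), F s) = F t

/-- `W` is an `id_H`-cylindrical Wiener process on `[0, T]` with respect to `F`. Here `W t h` is
the random variable `⟨h, W_t⟩_H`. -/
structure IsCylindricalWiener {T : ℝ} (P : Measure Ω)
    (F : Filtration (Set.Icc (0 : ℝ) T) mΩ)
    (W : Set.Icc (0 : ℝ) T → H → Ω → ℝ) : Prop where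
  adapted : ∀ t h, Measurable[F t] (W t h)
  linear : ∀ t (a : ℝ) (g h : H), ∀ᵐ ω ∂P, W t (a • g + h) ω = a * W t g ω + W t h ω
  zero : ∀ t : Set.Icc (0 : ℝ) T, (t : ℝ) = 0 → ∀ h, ∀ᵐ ω ∂P, W t h ω = 0
  continuous : ∀ h, ∀ᵐ ω ∂P, Continuous fun t => W t h ω
  indep : ∀ s t : Set.Icc (0 : ℝ) T, s ≤ t → ∀ h,
    Indep (MeasurableSpace.comap (fun ω => W t h ω - W s h ω) inferInstance) (F s) P
  law : ∀ s t : Set.Icc (0 : ℝ) T, s ≤ t → ∀ h,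
    P.map (fun ω => W t h ω - W s h ω)
      = gaussianReal 0 (Real.toNNReal (((t : ℝ) - (s : ℝ)) * ‖h‖ ^ 2))

/-! ### The stochastic integral of a deterministic operator-valued integrand -/

/-- An elementary integrand: the operator-valued step function
`s ↦ ∑ k, 1_{(a k, b k]}(s) ⟨h k, ·⟩_H u k` on `[0, T]`. -/
structure ElementaryIntegrand (T : ℝ) (H U : Type*) where
  n : ℕ
  a : Fin n → Set.Icc (0 : ℝ) T
  b : Fin n → Set.Icc (0 : ℝ) T
  a_le_b : ∀ k, a k ≤ b k
  h : Fin n → H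
  u : Fin n → U

variable {U : Type*} [NormedAddCommGroup U] [InnerProductSpace ℝ U]

/-- The value at time `s` of an elementary integrand, applied to `v`. -/
def ElementaryIntegrand.eval {T : ℝ} (Ψ : ElementaryIntegrand T H U) (s : ℝ) (v : H) : U :=
  ∑ k, (Set.Ioc (Ψ.a k : ℝ) (Ψ.b k : ℝ)).indicator (fun _ => ⟪Ψ.h k, v⟫_ℝ • Ψ.u k) s

/-- The stochastic integral over `[0, T]` of an elementary integrand. -/
def ElementaryIntegrand.integral {T : ℝ} (Ψ : ElementaryIntegrand T H U)
    (W : Set.Icc (0 : ℝ) T → H → Ω → ℝ) (ω : Ω) : U :=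
  ∑ k, (W (Ψ.b k) (Ψ.h k) ω - W (Ψ.a k) (Ψ.h k) ω) • Ψ.u k

/-- The square of the Hilbert–Schmidt norm of a linear operator `L` on `H`, computed in the
orthonormal basis `b` (its value does not depend on `b`). -/
def hsNormSq {ι : Type*} (b : HilbertBasis ι ℝ H) (L : H → U) : ℝ≥0∞ :=
  ∑' i, ‖L (b i)‖ₑ ^ 2

/-- `X = ∫_0^T Φ(s) dW_s` almost surely, for a deterministic integrand `Φ` whose values are
Hilbert–Schmidt operators from `H` to `U`: the random variable `X` is the limit in
`L²(Ω; U)` of the integrals of elementary integrands which converge to `Φ`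
in `L²([0, T]; HS(H, U))`. -/
def IsStochasticIntegral {T : ℝ} {ι : Type*} (b : HilbertBasis ι ℝ H) (P : Measure Ω)
    (W : Set.Icc (0 : ℝ) T → H → Ω → ℝ) (Φ : ℝ → H → U) (X : Ω → U) : Prop :=
  (∀ v, AEStronglyMeasurable (fun s => Φ s v) (volume.restrict (Set.Icc 0 T))) ∧
  AEStronglyMeasurable X P ∧
  ∃ Ψ : ℕ → ElementaryIntegrand T H U,
    Tendsto (fun n => ∫⁻ s in Set.Icc 0 T, hsNormSq b (fun v => (Ψ n).eval s v - Φ s v))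
      atTop (𝓝 0) ∧
    Tendsto (fun n => ∫⁻ ω, ‖(Ψ n).integral W ω - X ω‖ₑ ^ 2 ∂P) atTop (𝓝 0)

end Wiener

/-! ### The spaces and operators of the stochastic wave equation

Throughout, `b` is an orthonormal basis of `H` and `A` is the diagonal operator
`A v = ∑ i, lam i ⟨b i, v⟩ b i` with its maximal domain, where `sup lam < 0`. -/

section Wave

variable {ι : Type*} {H : Type*} [NormedAddCommGroup H] [InnerProductSpace ℝ H]
variable {E : Type*} [NormedAddCommGroup E] [InnerProductSpace ℝ E]

/-- For `r ≤ 0`: the complete space `E`, with the embedding `j : H → E`, is the interpolation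
space `H_r` associated to `-A`, i.e. the completion of `H` for the norm `v ↦ ‖(-A)^r v‖_H`, where
`‖(-A)^r v‖_H² = ∑ i, (|lam i|^r ⟨b i, v⟩)²`. -/
structure IsInterpolationSpace (b : HilbertBasis ι ℝ H) (lam : ι → ℝ) (r : ℝ)
    (j : H →ₗ[ℝ] E) : Prop where
  norm_sq : ∀ v : H, HasSum (fun i => (|lam i| ^ r * ⟪b i, v⟫_ℝ) ^ 2) (‖j v‖ ^ 2)
  dense : DenseRange j

/-- The Hilbert space `𝐇_0 = H_0 × H_{-1/2}`, with `H_0 = H` and `H_{-1/2} = E`. -/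
abbrev Phase (H E : Type*) : Type _ := WithLp 2 (H × E)

/-- The graph of `𝐀 (v, w) = (w, A v)` with domain `𝐇_1 = H_{1/2} × H_0`: here
`H_{1/2} = D((-A)^{1/2})` is the set of all `v` with `∑ i, |lam i| ⟨b i, v⟩² < ∞`, the space `H_0`
is the range of `j` in `E`, and `A` denotes the continuous extension
`v ↦ ∑ i, lam i ⟨b i, v⟩ b i` from `H_{1/2}` to `H_{-1/2}`. -/
def WaveOperator (b : HilbertBasis ι ℝ H) (lam : ι → ℝ) (j : H →ₗ[ℝ] E)
    (x y : Phase H E) : Prop :=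
  Summable (fun i => |lam i| * ⟪b i, x.fst⟫_ℝ ^ 2) ∧
  x.snd = j y.fst ∧
  HasSum (fun i => (lam i * ⟪b i, x.fst⟫_ℝ) • j (b i)) y.snd

/-- The map `u ↦ ∑_{i ∈ I} ⟨f i, u⟩ f i`. -/
def proj (f : ι → E) (I : Set ι) (u : E) : E := ∑' i : I, ⟪f i, u⟫_ℝ • f i

/-- The projection `𝐏_I (v, w) = (P_I v, P_I w)` on `𝐇_0`, where `P_I` is the orthogonal projection
on `H_r` given by the orthonormal vectors `|lam i|^{-r} b i`, `i ∈ I`, for `r = 0` in the first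
and `r = -1/2` in the second component. -/
def phaseProj (b : HilbertBasis ι ℝ H) (lam : ι → ℝ) (j : H →ₗ[ℝ] E) (I : Set ι)
    (x : Phase H E) : Phase H E :=
  WithLp.toLp 2
    (proj b I x.fst, proj (fun i => (|lam i| ^ (1 / 2 : ℝ)) • j (b i)) I x.snd)

/-- The operator `𝐁 v = (0, ∑ i, mu i ⟨b i, v⟩ b i)` from `H` to `𝐇_0`, the series being taken in
`H_{-1/2}`. -/
def noiseOperator (b : HilbertBasis ι ℝ H) (mu : ι → ℝ) (j : H →ₗ[ℝ] E) (v : H) : Phase H E :=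
  WithLp.toLp 2 (0, ∑' i, (mu i * ⟪b i, v⟫_ℝ) • j (b i))

end Wave

end StochWave

end

open StochWave

open StochWave

/-! By the Itô isometry, the second moment of `X I` is the integral over `[0, T]` of the squared
Hilbert–Schmidt norm of `e^{(T-s)𝐀} 𝐏_I 𝐁` (`IsStochasticIntegral.isometry`). This operator sends `b
i` to `mu i • e^{(T-s)𝐀} (0, b i)` if `i ∈ I` and to `0` otherwise. On the plane of `(b i, 0)` and
`(0, b i)` the wave operator is a harmonic oscillator of frequency `√|lam i|` (`apply_oscillator`),
which conserves the energy norm, so `(0, b i)` keeps its squared norm `|lam i|⁻¹` at all times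
(`norm_semigroup_mode_sq`).

Hence the second moment is `T ∑_{i ∈ I} mu i ^ 2 / |lam i|`, whose `n`-th term is `c^(2δ-1) n^(-q)`
with `q = p(1-2δ) > 1`. The series converges, and the difference in question is exactly its tail
over `n > N`. Comparing the tail with the integral of `x^(-q)` over `(N+1, ∞)` and using `N + 1 ≤
2N` gives the bound (`rpow_le_tsum_tail`). -/

namespace StochWave

/-! ### Covariance of the cylindrical Wiener process -/

section Covariance

variable {Ω : Type*} {mΩ : MeasurableSpace Ω} {H : Type*} [NormedAddCommGroup H]
  [InnerProductSpace ℝ H] {T : ℝ} {P : Measure Ω} {F : Filtration (Set.Icc (0 : ℝ) T) mΩ}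
  {W : Set.Icc (0 : ℝ) T → H → Ω → ℝ}

namespace IsCylindricalWiener

lemma measurable (hW : IsCylindricalWiener P F W) (t : Set.Icc (0 : ℝ) T) (h : H) :
    Measurable (W t h) :=
  (hW.adapted t h).mono (F.le t) le_rfl

lemma memLp_increment (hW : IsCylindricalWiener P F W) {s t : Set.Icc (0 : ℝ) T} (hst : s ≤ t)
    (h : H) : MemLp (fun ω => W t h ω - W s h ω) 2 P := by
  have hm : Measurable (fun ω => W t h ω - W s h ω) := (hW.measurable t h).sub (hW.measurable s h)
  have h1 := memLp_id_gaussianReal (μ := 0)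
    (v := Real.toNNReal (((t : ℝ) - (s : ℝ)) * ‖h‖ ^ 2)) 2
  rw [← hW.law s t hst h] at h1
  exact (memLp_map_measure_iff aestronglyMeasurable_id hm.aemeasurable).1 h1

lemma integral_increment (hW : IsCylindricalWiener P F W) {s t : Set.Icc (0 : ℝ) T} (hst : s ≤ t)
    (h : H) : ∫ ω, (W t h ω - W s h ω) ∂P = 0 := by
  have hm : Measurable (fun ω => W t h ω - W s h ω) := (hW.measurable t h).sub (hW.measurable s h)
  have h1 := integral_id_gaussianReal (μ := 0)
    (v := Real.toNNReal (((t : ℝ) - (s : ℝ)) * ‖h‖ ^ 2))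
  rw [← hW.law s t hst h, integral_map hm.aemeasurable (by fun_prop)] at h1
  exact h1

lemma integral_increment_sq (hW : IsCylindricalWiener P F W) {s t : Set.Icc (0 : ℝ) T}
    (hst : s ≤ t) (h : H) :
    ∫ ω, (W t h ω - W s h ω) ^ 2 ∂P = ((t : ℝ) - s) * ‖h‖ ^ 2 := by
  have hm : Measurable (fun ω => W t h ω - W s h ω) := (hW.measurable t h).sub (hW.measurable s h)
  have h1 := variance_id_gaussianReal (μ := 0)
    (v := Real.toNNReal (((t : ℝ) - (s : ℝ)) * ‖h‖ ^ 2))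
  rw [← hW.law s t hst h, variance_id_map hm.aemeasurable,
    variance_of_integral_eq_zero hm.aemeasurable (hW.integral_increment hst h),
    Real.coe_toNNReal _ (mul_nonneg (sub_nonneg.2 hst) (sq_nonneg _))] at h1
  exact h1

/-- Almost surely, `W` is the increment from the initial time. -/
lemma ae_eq_increment_zero (hW : IsCylindricalWiener P F W) (t : Set.Icc (0 : ℝ) T) (h : H) :
    ∃ o : Set.Icc (0 : ℝ) T, (o : ℝ) = 0 ∧ o ≤ t ∧
      (fun ω => W t h ω - W o h ω) =ᵐ[P] W t h := by
  refine ⟨⟨0, le_rfl, t.2.1.trans t.2.2⟩, rfl, t.2.1, ?_⟩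
  filter_upwards [hW.zero ⟨0, le_rfl, t.2.1.trans t.2.2⟩ rfl h] with ω hω
  simp [hω]

lemma memLp (hW : IsCylindricalWiener P F W) (t : Set.Icc (0 : ℝ) T) (h : H) :
    MemLp (W t h) 2 P := by
  obtain ⟨o, -, hot, hae⟩ := hW.ae_eq_increment_zero t h
  exact (memLp_congr_ae hae).1 (hW.memLp_increment hot h)

lemma integral_sq (hW : IsCylindricalWiener P F W) (t : Set.Icc (0 : ℝ) T) (h : H) :
    ∫ ω, W t h ω ^ 2 ∂P = t * ‖h‖ ^ 2 := by
  obtain ⟨o, ho, hot, hae⟩ := hW.ae_eq_increment_zero t h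
  have h1 := hW.integral_increment_sq hot h
  rw [ho, sub_zero] at h1
  rw [← h1]
  refine integral_congr_ae ?_
  filter_upwards [hae] with ω hω
  rw [hω]

lemma integrable_mul (hW : IsCylindricalWiener P F W) (s t : Set.Icc (0 : ℝ) T) (g h : H) :
    Integrable (fun ω => W s g ω * W t h ω) P :=
  (hW.memLp s g).integrable_mul (hW.memLp t h)

/-- Polarization: `W t (g + h)` is almost surely `W t g + W t h`, and all three second moments are
known. -/
lemma integral_mul_self_time (hW : IsCylindricalWiener P F W) (t : Set.Icc (0 : ℝ) T) (g h : H) :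
    ∫ ω, W t g ω * W t h ω ∂P = t * ⟪g, h⟫_ℝ := by
  have h1 := hW.integral_sq t (g + h)
  have h2 : ∫ ω, W t (g + h) ω ^ 2 ∂P
      = ∫ ω, W t g ω ^ 2 + 2 * (W t g ω * W t h ω) + W t h ω ^ 2 ∂P := by
    refine integral_congr_ae ?_
    filter_upwards [hW.linear t 1 g h] with ω hω
    rw [one_smul, one_mul] at hω
    rw [hω]; ring
  have hi : Integrable (fun ω => W t g ω ^ 2 + 2 * (W t g ω * W t h ω)) P :=
    (hW.memLp t g).integrable_sq.add ((hW.integrable_mul t t g h).const_mul 2)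
  rw [h2, integral_add hi (hW.memLp t h).integrable_sq, integral_add (hW.memLp t g).integrable_sq
    ((hW.integrable_mul t t g h).const_mul 2), integral_const_mul, hW.integral_sq, hW.integral_sq,
    norm_add_sq_real] at h1
  linarith

/-- Split `W t h` at time `s`: the increment is centred and independent of `F s`, so only `W s h`
contributes. -/
lemma integral_mul_of_le (hW : IsCylindricalWiener P F W) {s t : Set.Icc (0 : ℝ) T} (hst : s ≤ t)
    (g h : H) : ∫ ω, W s g ω * W t h ω ∂P = s * ⟪g, h⟫_ℝ := by
  have hm : Measurable (fun ω => W t h ω - W s h ω) := (hW.measurable t h).sub (hW.measurable s h)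
  have hind : IndepFun (fun ω => W t h ω - W s h ω) (W s g) P := by
    rw [IndepFun_iff_Indep]
    exact indep_of_indep_of_le_right (hW.indep s t hst h) (hW.adapted s g).comap_le
  have h0 : ∫ ω, (W t h ω - W s h ω) * W s g ω ∂P = 0 := by
    rw [hind.integral_fun_mul_eq_mul_integral hm.aestronglyMeasurable
      (hW.measurable s g).aestronglyMeasurable, hW.integral_increment hst, zero_mul]
  have h1 : ∫ ω, W s g ω * W t h ω ∂P
      = ∫ ω, (W t h ω - W s h ω) * W s g ω + W s g ω * W s h ω ∂P :=
    integral_congr_ae (.of_forall fun ω => by ring)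
  have hi : Integrable (fun ω => (W t h ω - W s h ω) * W s g ω) P :=
    (hW.memLp_increment hst h).integrable_mul (hW.memLp s g)
  rw [h1, integral_add hi (hW.integrable_mul s s g h), h0, hW.integral_mul_self_time, zero_add]

lemma integral_mul (hW : IsCylindricalWiener P F W) (s t : Set.Icc (0 : ℝ) T) (g h : H) :
    ∫ ω, W s g ω * W t h ω ∂P = min (s : ℝ) t * ⟪g, h⟫_ℝ := by
  rcases le_total s t with hst | hst
  · rw [hW.integral_mul_of_le hst, min_eq_left (by exact_mod_cast hst)]
  · rw [min_eq_right (by exact_mod_cast hst), real_inner_comm, ← hW.integral_mul_of_le hst]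
    simp_rw [mul_comm]

lemma integral_increment_mul (hW : IsCylindricalWiener P F W) (s t s' t' : Set.Icc (0 : ℝ) T)
    (g h : H) :
    ∫ ω, (W t g ω - W s g ω) * (W t' h ω - W s' h ω) ∂P
      = (min (t : ℝ) t' - min (t : ℝ) s' - min (s : ℝ) t' + min (s : ℝ) s') * ⟪g, h⟫_ℝ := by
  have h1 : ∫ ω, (W t g ω - W s g ω) * (W t' h ω - W s' h ω) ∂P
      = ∫ ω, W t g ω * W t' h ω - W t g ω * W s' h ω - W s g ω * W t' h ω
          + W s g ω * W s' h ω ∂P :=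
    integral_congr_ae (.of_forall fun ω => by ring)
  have hi : Integrable (fun ω => W t g ω * W t' h ω - W t g ω * W s' h ω) P :=
    (hW.integrable_mul _ _ _ _).sub (hW.integrable_mul _ _ _ _)
  have hi' : Integrable (fun ω => W t g ω * W t' h ω - W t g ω * W s' h ω - W s g ω * W t' h ω) P :=
    hi.sub (hW.integrable_mul _ _ _ _)
  rw [h1, integral_add hi' (hW.integrable_mul _ _ _ _), integral_sub hi (hW.integrable_mul _ _ _ _),
    integral_sub (hW.integrable_mul _ _ _ _) (hW.integrable_mul _ _ _ _)]
  simp only [hW.integral_mul]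
  ring

end IsCylindricalWiener

end Covariance

/-! ### Orbits of strongly continuous semigroups -/

section Semigroup

variable {U : Type*} [NormedAddCommGroup U] [NormedSpace ℝ U]
  {S : ℝ → U →L[ℝ] U} {G : U → U → Prop}

namespace IsSemigroupGeneratedBy

/-- Otherwise the norms blow up along times tending to `0`, against Banach–Steinhaus. Asking for `M
≥ 1` makes the powers of `M` in `exists_bound` increasing. -/
lemma exists_bound_near_zero [CompleteSpace U] (hS : IsSemigroupGeneratedBy S G) :
    ∃ ε > 0, ∃ M ≥ 1, ∀ t ∈ Set.Icc 0 ε, ‖S t‖ ≤ M := by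
  by_contra! hcon
  have hex : ∀ n : ℕ, ∃ t ∈ Set.Icc (0 : ℝ) (1 / ((n : ℝ) + 1)), (n : ℝ) + 1 < ‖S t‖ := fun n =>
    hcon _ (by positivity) _ (by simp)
  choose t ht hlt using hex
  -- Strong continuity is only given along positive times; time `0` is excluded because `‖S 0‖ ≤ 1`.
  have htpos : ∀ n, t (n + 1) ∈ Set.Ioi (0 : ℝ) := by
    intro n
    refine lt_of_le_of_ne (ht _).1 fun h0 => ?_
    have h1 := hlt (n + 1)
    rw [← h0, hS.zero] at h1
    have h2 := ContinuousLinearMap.norm_id_le (𝕜 := ℝ) (E := U)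
    push_cast at h1
    have h3 : (0 : ℝ) ≤ n := n.cast_nonneg
    linarith
  have ht0 : Tendsto t atTop (𝓝 0) :=
    squeeze_zero (fun n => (ht n).1) (fun n => (ht n).2) tendsto_one_div_add_atTop_nhds_zero_nat
  have ht1 : Tendsto (fun n => t (n + 1)) atTop (𝓝[>] 0) :=
    tendsto_nhdsWithin_iff.2 ⟨ht0.comp (tendsto_add_atTop_nat 1), .of_forall htpos⟩
  obtain ⟨C, hC⟩ := banach_steinhaus (g := fun n : ℕ => S (t (n + 1))) fun x => by
    obtain ⟨C, hC⟩ := (((hS.tendsto x).comp ht1).norm).bddAbove_range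
    exact ⟨C, fun n => hC ⟨n, rfl⟩⟩
  obtain ⟨n, hn⟩ := exists_nat_gt C
  have h1 := hlt (n + 1)
  have h2 := hC n
  push_cast at h1
  linarith

lemma exists_bound [CompleteSpace U] (hS : IsSemigroupGeneratedBy S G) (R : ℝ) :
    ∃ M, ∀ t ∈ Set.Icc 0 R, ‖S t‖ ≤ M := by
  obtain ⟨ε, hε, M, hM, hb⟩ := hS.exists_bound_near_zero
  have key : ∀ n : ℕ, ∀ t ∈ Set.Icc 0 ((n + 1) * ε), ‖S t‖ ≤ M ^ (n + 1) := by
    intro n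
    induction n with
    | zero => intro t ht; simpa using hb t (by simpa using ht)
    | succ n ih =>
      intro t ht
      rcases le_total t ε with h | h
      · exact (hb t ⟨ht.1, h⟩).trans (le_self_pow₀ hM (by simp))
      · have hsub : t - ε ∈ Set.Icc 0 ((n + 1) * ε) := by
          have := ht.2
          push_cast at this
          exact ⟨by linarith, by linarith⟩
        have h1 := hS.add (t - ε) ε hsub.1 hε.le
        rw [sub_add_cancel] at h1
        rw [h1, pow_succ]
        exact (ContinuousLinearMap.opNorm_comp_le _ _).trans
          (mul_le_mul (ih _ hsub) (hb _ ⟨hε.le, le_rfl⟩) (norm_nonneg _) (by positivity))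
  obtain ⟨n, hn⟩ := exists_nat_gt (R / ε)
  refine ⟨_, fun t ht => key n t ⟨ht.1, ht.2.trans ?_⟩⟩
  rw [div_lt_iff₀ hε] at hn
  linarith

/-- Factoring out `S` at the smaller of two times and bounding it uniformly reduces continuity from
both sides to right continuity at `0`. -/
lemma continuousOn [CompleteSpace U] (hS : IsSemigroupGeneratedBy S G) (R : ℝ) (x : U) :
    ContinuousOn (fun t => S t x) (Set.Icc 0 R) := by
  obtain ⟨M, hM⟩ := hS.exists_bound R
  have hlim : Tendsto (fun h => S h x - x) (𝓝[≥] 0) (𝓝 0) := by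
    have h1 : Tendsto (fun h => S h x - x) (𝓝[>] 0) (𝓝 0) := by
      simpa using (hS.tendsto x).sub_const x
    have h2 : ContinuousWithinAt (fun h => S h x - x) (Set.Ioi 0) 0 := by
      simpa [ContinuousWithinAt, hS.zero] using h1
    have h3 := continuousWithinAt_Ioi_iff_Ici.1 h2
    simpa [ContinuousWithinAt, hS.zero] using h3
  have hdiff : ∀ s ∈ Set.Icc 0 R, ∀ t ∈ Set.Icc 0 R,
      ‖S t x - S s x‖ ≤ M * ‖S |t - s| x - x‖ := by
    have aux : ∀ s ∈ Set.Icc 0 R, ∀ t ∈ Set.Icc 0 R, s ≤ t →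
        ‖S t x - S s x‖ ≤ M * ‖S |t - s| x - x‖ := by
      intro s hs t ht hst
      have h1 := hS.add s (t - s) hs.1 (by linarith)
      rw [add_sub_cancel] at h1
      rw [abs_of_nonneg (by linarith), h1, ContinuousLinearMap.comp_apply, ← map_sub]
      exact (ContinuousLinearMap.le_opNorm _ _).trans
        (mul_le_mul_of_nonneg_right (hM s hs) (norm_nonneg _))
    intro s hs t ht
    rcases le_total s t with h | h
    · exact aux s hs t ht h
    · rw [norm_sub_rev, abs_sub_comm]; exact aux t ht s hs h
  intro s hs
  have habs : Tendsto (fun t : ℝ => |t - s|) (𝓝[Set.Icc 0 R] s) (𝓝[≥] 0) := by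
    refine tendsto_nhdsWithin_iff.2 ⟨?_, .of_forall fun t => abs_nonneg (t - s)⟩
    have : Continuous fun t : ℝ => |t - s| := by fun_prop
    simpa using (this.tendsto s).mono_left nhdsWithin_le_nhds
  have h0 := ((hlim.comp habs).norm).const_mul M
  rw [norm_zero, mul_zero] at h0
  refine tendsto_iff_norm_sub_tendsto_zero.2 (squeeze_zero' (.of_forall fun t => norm_nonneg _) ?_ h0)
  filter_upwards [self_mem_nhdsWithin] with t ht using hdiff s hs t ht

/-- The difference quotient at `t` is `S t` applied to the one at `0`. Only the right derivative is
obtained, which suffices for ODE uniqueness. -/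
lemma hasDerivWithinAt (hS : IsSemigroupGeneratedBy S G) {x y : U} (hxy : G x y) {t : ℝ}
    (ht : 0 ≤ t) : HasDerivWithinAt (fun t => S t x) (S t y) (Set.Ici t) t := by
  rw [← hasDerivWithinAt_Ioi_iff_Ici, hasDerivWithinAt_iff_tendsto_slope' (by simp)]
  have h1 := ((S t).continuous.tendsto y).comp ((hS.generator x y).1 hxy)
  have h2 : Tendsto (fun r : ℝ => r - t) (𝓝[>] t) (𝓝[>] 0) := by
    refine tendsto_nhdsWithin_iff.2 ⟨?_, ?_⟩
    · have : Continuous fun r : ℝ => r - t := by fun_prop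
      simpa using (this.tendsto t).mono_left nhdsWithin_le_nhds
    · filter_upwards [self_mem_nhdsWithin] with r hr using Set.mem_Ioi.2 (sub_pos.2 (Set.mem_Ioi.1 hr))
  refine (h1.comp h2).congr' ?_
  filter_upwards [self_mem_nhdsWithin] with r hr
  have h3 := hS.add t (r - t) ht (sub_pos.2 (Set.mem_Ioi.1 hr)).le
  rw [add_sub_cancel] at h3
  simp [slope_def_module, h3]

/-- The orbits of a two-dimensional oscillator block of the generator. -/
lemma apply_oscillator [CompleteSpace U] (hS : IsSemigroupGeneratedBy S G) {x y : U} {κ : ℝ}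
    (hκ : 0 < κ) (hx : G x (-κ ^ 2 • y)) (hy : G y x) {t : ℝ} (ht : 0 ≤ t) :
    S t y = (Real.sin (κ * t) / κ) • x + Real.cos (κ * t) • y := by
  -- The pair `(S t x, S t y)` solves the linear system `(u, v)' = (-κ² v, u)`; `g` is its explicit
  -- solution starting at `(x, y)`.
  let L : U × U →L[ℝ] U × U :=
    ((-κ ^ 2) • ContinuousLinearMap.snd ℝ U U).prod (ContinuousLinearMap.fst ℝ U U)
  let f : ℝ → U × U := fun t => (S t x, S t y)
  let g : ℝ → U × U := fun t =>
    (Real.cos (κ * t) • x - (κ * Real.sin (κ * t)) • y,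
      (Real.sin (κ * t) / κ) • x + Real.cos (κ * t) • y)
  have hgd : ∀ r, HasDerivAt g (L (g r)) r := by
    intro r
    have hlin : HasDerivAt (fun r : ℝ => κ * r) κ r := by
      simpa using (hasDerivAt_id r).const_mul κ
    have hs := (Real.hasDerivAt_sin (κ * r)).comp r hlin
    have hc := (Real.hasDerivAt_cos (κ * r)).comp r hlin
    refine HasDerivAt.congr_deriv (HasDerivAt.prodMk
      ((hc.smul_const x).sub ((hs.const_mul κ).smul_const y))
      (((hs.div_const κ).smul_const x).add (hc.smul_const y))) ?_
    simp only [L, g, ContinuousLinearMap.prod_apply, smul_apply,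
      ContinuousLinearMap.coe_fst', ContinuousLinearMap.coe_snd', Prod.mk.injEq]
    constructor
    · match_scalars
      · field_simp
      · ring
    · match_scalars
      · field_simp
      · ring
  have huniq := ODE_solution_unique (v := fun _ => L) (f := f) (g := g) (a := 0) (b := t)
    (fun _ => L.lipschitz) ((hS.continuousOn t x).prodMk (hS.continuousOn t y))
    (fun r hr => by
      refine ((hS.hasDerivWithinAt hx hr.1).prodMk (hS.hasDerivWithinAt hy hr.1)).congr_deriv ?_
      simp [L, f])
    (fun r _ => (hgd r).continuousAt.continuousWithinAt)
    (fun r _ => (hgd r).hasDerivWithinAt) (by simp [f, g, hS.zero])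
  exact congrArg Prod.snd (huniq ⟨ht, le_rfl⟩)

end IsSemigroupGeneratedBy

end Semigroup

/-- A lower bound for the tail of the series `∑ n ^ (-q)`. -/
lemma rpow_le_tsum_tail {q : ℝ} (hq : 1 < q) {N : ℕ} (hN : 0 < N) :
    (N : ℝ) ^ (1 - q) / ((q - 1) * 2 ^ (q - 1)) ≤ ∑' k : ℕ, ((N + 1 + k : ℕ) : ℝ) ^ (-q) := by
  have hpos : (0 : ℝ) < N + 1 := by positivity
  have hsum : Summable (fun k : ℕ => ((N + 1 + k : ℕ) : ℝ) ^ (-q)) := by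
    have := (summable_nat_add_iff (N + 1)).2 (Real.summable_nat_rpow.2 (by linarith : -q < -1))
    simpa only [add_comm] using this
  have hanti : AntitoneOn (fun x : ℝ => x ^ (-q)) (Set.Ioi 0) := fun x hx y hy hxy =>
    Real.rpow_le_rpow_of_nonpos hx hxy (by linarith)
  -- As `x ^ (-q)` decreases, left-endpoint sums dominate the integral.
  have hle : ∀ a : ℕ, ∫ x in (N + 1 : ℝ)..(N + 1 + a : ℝ), x ^ (-q)
      ≤ ∑' k : ℕ, ((N + 1 + k : ℕ) : ℝ) ^ (-q) := by
    intro a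
    refine (AntitoneOn.integral_le_sum (hanti.mono fun x hx => hpos.trans_le hx.1)).trans ?_
    have := hsum.sum_le_tsum (Finset.range a) (fun _ _ => by positivity)
    push_cast at this ⊢
    exact this
  have hlim : Tendsto (fun a : ℕ => ∫ x in (N + 1 : ℝ)..(N + 1 + a : ℝ), x ^ (-q)) atTop
      (𝓝 (∫ x in Set.Ioi (N + 1 : ℝ), x ^ (-q))) :=
    intervalIntegral_tendsto_integral_Ioi _ (integrableOn_Ioi_rpow_of_lt (by linarith) hpos)
      (tendsto_atTop_add_const_left _ _ tendsto_natCast_atTop_atTop)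
  have hfin := le_of_tendsto' hlim hle
  rw [integral_Ioi_rpow_of_lt (by linarith) hpos] at hfin
  refine le_trans ?_ hfin
  have h1 : -(N + 1 : ℝ) ^ (-q + 1) / (-q + 1) = (N + 1 : ℝ) ^ (1 - q) / (q - 1) := by
    rw [show -q + 1 = -(q - 1) by ring, neg_div_neg_eq, show -(q - 1) = 1 - q by ring]
  -- The factor `2 ^ (q - 1)` pays for replacing `N + 1` by `2 * N`: the exponent `1 - q` is
  -- negative and `N ≥ 1`.
  have h2 : (N : ℝ) ^ (1 - q) / ((q - 1) * 2 ^ (q - 1)) = (2 * N : ℝ) ^ (1 - q) / (q - 1) := by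
    rw [Real.mul_rpow (by norm_num) (by positivity), show 1 - q = -(q - 1) by ring,
      Real.rpow_neg (by norm_num : (0 : ℝ) ≤ 2)]
    field_simp
  rw [h1, h2]
  have hN1 : (1 : ℝ) ≤ N := by exact_mod_cast hN
  refine div_le_div_of_nonneg_right ?_ (by linarith)
  exact Real.rpow_le_rpow_of_nonpos hpos (by linarith) (by linarith)

/-! ### The Itô isometry -/

section Isometry

lemma norm_sum_smul_sq {U κ : Type*} [NormedAddCommGroup U] [InnerProductSpace ℝ U] [Fintype κ]
    (x : κ → ℝ) (u : κ → U) :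
    ‖∑ k, x k • u k‖ ^ 2 = ∑ k, ∑ l, ⟪u k, u l⟫_ℝ * (x k * x l) := by
  rw [← real_inner_self_eq_norm_sq, sum_inner]
  refine Finset.sum_congr rfl fun k _ => ?_
  rw [inner_sum]
  refine Finset.sum_congr rfl fun l _ => ?_
  rw [real_inner_smul_left, real_inner_smul_right]
  ring

lemma enorm_sq_eq_ofReal {U : Type*} [NormedAddCommGroup U] (x : U) :
    ‖x‖ₑ ^ 2 = ENNReal.ofReal (‖x‖ ^ 2) := by
  rw [← ofReal_norm, ENNReal.ofReal_pow (norm_nonneg x)]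

lemma indicator_one_mul_indicator_one {α : Type*} (A B : Set α) (s : α) :
    A.indicator (fun _ => (1 : ℝ)) s * B.indicator (fun _ => (1 : ℝ)) s
      = (A ∩ B).indicator (fun _ => (1 : ℝ)) s := by
  by_cases hA : s ∈ A <;> by_cases hB : s ∈ B <;> simp [hA, hB]

/-- The length of the overlap of the two intervals, put in the form in which it appears in
`integral_increment_mul`, so that both sides of the isometry become the same Gram sum. -/
lemma setIntegral_indicator_Ioc_mul {T : ℝ} (a b a' b' : Set.Icc (0 : ℝ) T) (hab : a ≤ b)
    (hab' : a' ≤ b') :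
    ∫ s in Set.Icc 0 T, (Set.Ioc (a : ℝ) b).indicator (fun _ => (1 : ℝ)) s
        * (Set.Ioc (a' : ℝ) b').indicator (fun _ => (1 : ℝ)) s
      = min (b : ℝ) b' - min (b : ℝ) a' - min (a : ℝ) b' + min (a : ℝ) a' := by
  have h1 : ∀ s, (Set.Ioc (a : ℝ) b).indicator (fun _ => (1 : ℝ)) s
        * (Set.Ioc (a' : ℝ) b').indicator (fun _ => (1 : ℝ)) s
      = (Set.Ioc (max (a : ℝ) a') (min (b : ℝ) b')).indicator (fun _ => (1 : ℝ)) s := by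
    intro s
    rw [← Set.Ioc_inter_Ioc, indicator_one_mul_indicator_one]
  simp_rw [h1]
  have h2 : Set.Ioc (max (a : ℝ) a') (min (b : ℝ) b') ∩ Set.Icc 0 T
      = Set.Ioc (max (a : ℝ) a') (min (b : ℝ) b') := by
    refine Set.inter_eq_left.2 fun s hs => ?_
    exact ⟨a.2.1.trans ((le_max_left _ _).trans hs.1.le),
      hs.2.trans ((min_le_left _ _).trans b.2.2)⟩
  rw [integral_indicator_const _ measurableSet_Ioc, smul_eq_mul, mul_one,
    measureReal_restrict_apply measurableSet_Ioc, h2, Real.volume_real_Ioc]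
  have hab : (a : ℝ) ≤ b := hab
  have hab' : (a' : ℝ) ≤ b' := hab'
  rcases le_total (a : ℝ) a' with h3 | h3 <;> rcases le_total (b : ℝ) b' with h4 | h4 <;>
    rcases le_total (b : ℝ) a' with h5 | h5 <;> rcases le_total (a : ℝ) b' with h6 | h6 <;>
    simp only [max_eq_left, max_eq_right, min_eq_left, min_eq_right, h3, h4, h5, h6] <;>
    first
    | (rw [max_eq_left (by linarith)]; linarith)
    | (rw [max_eq_right (by linarith)]; linarith)

variable {Ω : Type*} {mΩ : MeasurableSpace Ω} {H : Type*} [NormedAddCommGroup H]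
  [InnerProductSpace ℝ H] {T : ℝ} {P : Measure Ω} {F : Filtration (Set.Icc (0 : ℝ) T) mΩ}
  {W : Set.Icc (0 : ℝ) T → H → Ω → ℝ}
  {U : Type*} [NormedAddCommGroup U] [InnerProductSpace ℝ U] {ι : Type*}

namespace ElementaryIntegrand

/-- The pointwise squared Hilbert–Schmidt norm of an elementary integrand, as a Gram sum. -/
lemma hasSum_norm_eval_sq (b : HilbertBasis ι ℝ H) (Ψ : ElementaryIntegrand T H U) (s : ℝ) :
    HasSum (fun i => ‖Ψ.eval s (b i)‖ ^ 2)
      (∑ k, ∑ l, ⟪Ψ.u k, Ψ.u l⟫_ℝ * ⟪Ψ.h k, Ψ.h l⟫_ℝ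
        * ((Set.Ioc (Ψ.a k : ℝ) (Ψ.b k)).indicator (fun _ => (1 : ℝ)) s
          * (Set.Ioc (Ψ.a l : ℝ) (Ψ.b l)).indicator (fun _ => (1 : ℝ)) s)) := by
  have h1 : ∀ i, Ψ.eval s (b i) = ∑ k, ((Set.Ioc (Ψ.a k : ℝ) (Ψ.b k)).indicator
      (fun _ => (1 : ℝ)) s * ⟪Ψ.h k, b i⟫_ℝ) • Ψ.u k := by
    intro i
    refine Finset.sum_congr rfl fun k _ => ?_
    by_cases hs : s ∈ Set.Ioc (Ψ.a k : ℝ) (Ψ.b k)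
    · simp [Set.indicator_of_mem hs]
    · simp [Set.indicator_of_notMem hs]
  simp_rw [h1, norm_sum_smul_sq]
  refine hasSum_sum fun k _ => hasSum_sum fun l _ => ?_
  -- Parseval in the basis `b` turns each pair of terms into `⟪Ψ.h k, Ψ.h l⟫`.
  have h2 := (b.hasSum_inner_mul_inner (Ψ.h k) (Ψ.h l)).mul_left (⟪Ψ.u k, Ψ.u l⟫_ℝ
    * ((Set.Ioc (Ψ.a k : ℝ) (Ψ.b k)).indicator (fun _ => (1 : ℝ)) s
      * (Set.Ioc (Ψ.a l : ℝ) (Ψ.b l)).indicator (fun _ => (1 : ℝ)) s))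
  rw [mul_right_comm]
  refine h2.congr_fun fun i => ?_
  rw [real_inner_comm (Ψ.h l) (b i)]
  ring

lemma hsNormSq_eval (b : HilbertBasis ι ℝ H) (Ψ : ElementaryIntegrand T H U) (s : ℝ) :
    hsNormSq b (Ψ.eval s) = ENNReal.ofReal (∑ k, ∑ l, ⟪Ψ.u k, Ψ.u l⟫_ℝ * ⟪Ψ.h k, Ψ.h l⟫_ℝ
        * ((Set.Ioc (Ψ.a k : ℝ) (Ψ.b k)).indicator (fun _ => (1 : ℝ)) s
          * (Set.Ioc (Ψ.a l : ℝ) (Ψ.b l)).indicator (fun _ => (1 : ℝ)) s)) := by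
  have h1 := Ψ.hasSum_norm_eval_sq b s
  rw [← h1.tsum_eq, ENNReal.ofReal_tsum_of_nonneg (fun _ => sq_nonneg _) h1.summable]
  simp_rw [hsNormSq, enorm_sq_eq_ofReal]

lemma lintegral_hsNormSq_eval (b : HilbertBasis ι ℝ H) (Ψ : ElementaryIntegrand T H U) :
    ∫⁻ s in Set.Icc 0 T, hsNormSq b (Ψ.eval s)
      = ENNReal.ofReal (∑ k, ∑ l, ⟪Ψ.u k, Ψ.u l⟫_ℝ * ⟪Ψ.h k, Ψ.h l⟫_ℝ
        * (min (Ψ.b k : ℝ) (Ψ.b l) - min (Ψ.b k : ℝ) (Ψ.a l) - min (Ψ.a k : ℝ) (Ψ.b l)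
          + min (Ψ.a k : ℝ) (Ψ.a l))) := by
  have hint : ∀ k l, Integrable (fun s => ⟪Ψ.u k, Ψ.u l⟫_ℝ * ⟪Ψ.h k, Ψ.h l⟫_ℝ
        * ((Set.Ioc (Ψ.a k : ℝ) (Ψ.b k)).indicator (fun _ => (1 : ℝ)) s
          * (Set.Ioc (Ψ.a l : ℝ) (Ψ.b l)).indicator (fun _ => (1 : ℝ)) s))
        (volume.restrict (Set.Icc 0 T)) := by
    intro k l
    refine Integrable.const_mul ?_ _
    simp_rw [indicator_one_mul_indicator_one]
    exact (integrable_const _).indicator (measurableSet_Ioc.inter measurableSet_Ioc)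
  simp_rw [hsNormSq_eval]
  rw [← ofReal_integral_eq_lintegral_ofReal
    (integrable_finsetSum _ fun k _ => integrable_finsetSum _ fun l _ => hint k l)
    (.of_forall fun s => (Ψ.hasSum_norm_eval_sq b s).nonneg fun _ => sq_nonneg _),
    integral_finsetSum _ fun k _ => integrable_finsetSum _ fun l _ => hint k l]
  congr 1
  refine Finset.sum_congr rfl fun k _ => ?_
  rw [integral_finsetSum _ fun l _ => hint k l]
  refine Finset.sum_congr rfl fun l _ => ?_
  rw [integral_const_mul, setIntegral_indicator_Ioc_mul _ _ _ _ (Ψ.a_le_b k) (Ψ.a_le_b l)]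

lemma aestronglyMeasurable_integral (hW : IsCylindricalWiener P F W)
    (Ψ : ElementaryIntegrand T H U) : AEStronglyMeasurable (Ψ.integral W) P := by
  refine Finset.aestronglyMeasurable_fun_sum _ fun k _ => ?_
  exact ((hW.measurable _ _).sub (hW.measurable _ _)).aestronglyMeasurable.smul_const _

lemma aestronglyMeasurable_eval (Ψ : ElementaryIntegrand T H U) (v : H) (ν : Measure ℝ) :
    AEStronglyMeasurable (fun s => Ψ.eval s v) ν :=
  Finset.aestronglyMeasurable_fun_sum _ fun _ _ =>
    aestronglyMeasurable_const.indicator measurableSet_Ioc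

lemma lintegral_norm_integral_sq (hW : IsCylindricalWiener P F W)
    (Ψ : ElementaryIntegrand T H U) :
    ∫⁻ ω, ‖Ψ.integral W ω‖ₑ ^ 2 ∂P
      = ENNReal.ofReal (∑ k, ∑ l, ⟪Ψ.u k, Ψ.u l⟫_ℝ * ⟪Ψ.h k, Ψ.h l⟫_ℝ
        * (min (Ψ.b k : ℝ) (Ψ.b l) - min (Ψ.b k : ℝ) (Ψ.a l) - min (Ψ.a k : ℝ) (Ψ.b l)
          + min (Ψ.a k : ℝ) (Ψ.a l))) := by
  have hint : ∀ k l, Integrable (fun ω => ⟪Ψ.u k, Ψ.u l⟫_ℝ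
      * ((W (Ψ.b k) (Ψ.h k) ω - W (Ψ.a k) (Ψ.h k) ω)
        * (W (Ψ.b l) (Ψ.h l) ω - W (Ψ.a l) (Ψ.h l) ω))) P := fun k l =>
    ((hW.memLp_increment (Ψ.a_le_b k) _).integrable_mul
      (hW.memLp_increment (Ψ.a_le_b l) _)).const_mul _
  simp_rw [enorm_sq_eq_ofReal, ElementaryIntegrand.integral]
  have hnn : ∀ ω, 0 ≤ ∑ k, ∑ l, ⟪Ψ.u k, Ψ.u l⟫_ℝ
      * ((W (Ψ.b k) (Ψ.h k) ω - W (Ψ.a k) (Ψ.h k) ω)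
        * (W (Ψ.b l) (Ψ.h l) ω - W (Ψ.a l) (Ψ.h l) ω)) := fun ω => by
    rw [← norm_sum_smul_sq]; positivity
  simp_rw [norm_sum_smul_sq]
  rw [← ofReal_integral_eq_lintegral_ofReal
    (integrable_finsetSum _ fun k _ => integrable_finsetSum _ fun l _ => hint k l)
    (.of_forall hnn),
    integral_finsetSum _ fun k _ => integrable_finsetSum _ fun l _ => hint k l]
  congr 1
  refine Finset.sum_congr rfl fun k _ => ?_
  rw [integral_finsetSum _ fun l _ => hint k l]
  refine Finset.sum_congr rfl fun l _ => ?_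
  rw [integral_const_mul, hW.integral_increment_mul]
  ring

/-- The Itô isometry for elementary integrands. -/
lemma isometry (hW : IsCylindricalWiener P F W) (b : HilbertBasis ι ℝ H)
    (Ψ : ElementaryIntegrand T H U) :
    ∫⁻ ω, ‖Ψ.integral W ω‖ₑ ^ 2 ∂P = ∫⁻ s in Set.Icc 0 T, hsNormSq b (Ψ.eval s) := by
  rw [Ψ.lintegral_norm_integral_sq hW, Ψ.lintegral_hsNormSq_eval b]

end ElementaryIntegrand

/-- Young's inequality on the cross term `2 ‖y‖ ‖x - y‖`. This form can be summed and integrated in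
`ℝ≥0∞` with no finiteness assumption, and the main constant tends to `1` with `ε`. -/
lemma enorm_sq_le_add {V : Type*} [NormedAddCommGroup V] (x y : V) {ε : ℝ} (hε : 0 < ε) :
    ‖x‖ₑ ^ 2 ≤ ENNReal.ofReal (1 + ε) * ‖y‖ₑ ^ 2 + ENNReal.ofReal (1 + ε⁻¹) * ‖x - y‖ₑ ^ 2 := by
  simp_rw [enorm_sq_eq_ofReal]
  rw [← ENNReal.ofReal_mul (by positivity), ← ENNReal.ofReal_mul (by positivity),
    ← ENNReal.ofReal_add (by positivity) (by positivity)]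
  refine ENNReal.ofReal_le_ofReal ?_
  have h1 : ‖x‖ ≤ ‖y‖ + ‖x - y‖ := by simpa using norm_add_le y (x - y)
  have h2 : ‖x‖ ^ 2 ≤ (‖y‖ + ‖x - y‖) ^ 2 := by gcongr
  have h3 : 0 ≤ ε⁻¹ * (ε * ‖y‖ - ‖x - y‖) ^ 2 := by positivity
  have h4 : ε⁻¹ * (ε * ‖y‖ - ‖x - y‖) ^ 2
      = ε * ‖y‖ ^ 2 - 2 * (‖y‖ * ‖x - y‖) + ε⁻¹ * ‖x - y‖ ^ 2 := by
    field_simp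
    ring
  nlinarith

lemma lintegral_enorm_sq_le_add {V : Type*} [NormedAddCommGroup V] {α : Type*}
    {mα : MeasurableSpace α} {ν : Measure α} {f g : α → V}
    (hg : AEStronglyMeasurable g ν) {ε : ℝ} (hε : 0 < ε) :
    ∫⁻ x, ‖f x‖ₑ ^ 2 ∂ν ≤ ENNReal.ofReal (1 + ε) * ∫⁻ x, ‖g x‖ₑ ^ 2 ∂ν
      + ENNReal.ofReal (1 + ε⁻¹) * ∫⁻ x, ‖f x - g x‖ₑ ^ 2 ∂ν := by
  rw [← lintegral_const_mul' _ _ ENNReal.ofReal_ne_top,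
    ← lintegral_const_mul' _ _ ENNReal.ofReal_ne_top,
    ← lintegral_add_left' ((hg.enorm.pow_const 2).const_mul _)]
  exact lintegral_mono fun x => enorm_sq_le_add _ _ hε

lemma hsNormSq_le_add {V : Type*} [NormedAddCommGroup V] (b : HilbertBasis ι ℝ H) (K L : H → V)
    {ε : ℝ} (hε : 0 < ε) :
    hsNormSq b K ≤ ENNReal.ofReal (1 + ε) * hsNormSq b L
      + ENNReal.ofReal (1 + ε⁻¹) * hsNormSq b (fun v => K v - L v) := by
  simp only [hsNormSq]
  rw [← ENNReal.tsum_mul_left, ← ENNReal.tsum_mul_left, ← ENNReal.tsum_add]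
  exact ENNReal.tsum_le_tsum fun i => enorm_sq_le_add _ _ hε

lemma lintegral_hsNormSq_le_add {V : Type*} [NormedAddCommGroup V] [Countable ι]
    {α : Type*} {mα : MeasurableSpace α} {ν : Measure α}
    (b : HilbertBasis ι ℝ H) {f g : α → H → V}
    (hg : ∀ v, AEStronglyMeasurable (fun x => g x v) ν) {ε : ℝ} (hε : 0 < ε) :
    ∫⁻ x, hsNormSq b (f x) ∂ν ≤ ENNReal.ofReal (1 + ε) * ∫⁻ x, hsNormSq b (g x) ∂ν
      + ENNReal.ofReal (1 + ε⁻¹) * ∫⁻ x, hsNormSq b (fun v => f x v - g x v) ∂ν := by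
  have hm : AEMeasurable (fun x => hsNormSq b (g x)) ν :=
    AEMeasurable.tsum fun i => (hg (b i)).enorm.pow_const 2
  rw [← lintegral_const_mul' _ _ ENNReal.ofReal_ne_top,
    ← lintegral_const_mul' _ _ ENNReal.ofReal_ne_top, ← lintegral_add_left' (hm.const_mul _)]
  exact lintegral_mono fun x => hsNormSq_le_add b _ _ hε

/-- Chain the two bounds, let `n → ∞` with `ε` fixed to get `x ≤ (1 + ε)² y`, and only then let `ε →
0`. -/
lemma le_of_approx {x y : ℝ≥0∞} {a d d' : ℕ → ℝ≥0∞} (hd : Tendsto d atTop (𝓝 0))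
    (hd' : Tendsto d' atTop (𝓝 0))
    (hx : ∀ ε : ℝ, 0 < ε → ∀ n, x ≤ ENNReal.ofReal (1 + ε) * a n + ENNReal.ofReal (1 + ε⁻¹) * d n)
    (hy : ∀ ε : ℝ, 0 < ε → ∀ n,
      a n ≤ ENNReal.ofReal (1 + ε) * y + ENNReal.ofReal (1 + ε⁻¹) * d' n) : x ≤ y := by
  have h1 : ∀ ε : ℝ, 0 < ε → x ≤ ENNReal.ofReal (1 + ε) * (ENNReal.ofReal (1 + ε) * y) := by
    intro ε hε
    have hlim : Tendsto (fun n => ENNReal.ofReal (1 + ε) * (ENNReal.ofReal (1 + ε) * y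
        + ENNReal.ofReal (1 + ε⁻¹) * d' n) + ENNReal.ofReal (1 + ε⁻¹) * d n) atTop
        (𝓝 (ENNReal.ofReal (1 + ε) * (ENNReal.ofReal (1 + ε) * y + ENNReal.ofReal (1 + ε⁻¹) * 0)
          + ENNReal.ofReal (1 + ε⁻¹) * 0)) := by
      refine Tendsto.add (ENNReal.Tendsto.const_mul (tendsto_const_nhds.add
        (ENNReal.Tendsto.const_mul hd' ?_)) ?_) (ENNReal.Tendsto.const_mul hd ?_) <;>
      exact Or.inr ENNReal.ofReal_ne_top
    simp only [mul_zero, add_zero] at hlim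
    refine ge_of_tendsto' hlim fun n => (hx ε hε n).trans ?_
    gcongr
    exact hy ε hε n
  have hK : Tendsto (fun ε : ℝ => ENNReal.ofReal (1 + ε)) (𝓝[>] 0) (𝓝 1) := by
    have h2 : Continuous fun ε : ℝ => ENNReal.ofReal (1 + ε) :=
      ENNReal.continuous_ofReal.comp (by fun_prop)
    simpa using (h2.tendsto 0).mono_left nhdsWithin_le_nhds
  have hlim : Tendsto (fun ε : ℝ => ENNReal.ofReal (1 + ε) * ENNReal.ofReal (1 + ε) * y) (𝓝[>] 0)
      (𝓝 (1 * 1 * y)) :=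
    ENNReal.Tendsto.mul_const (ENNReal.Tendsto.mul hK (by simp) hK (by simp)) (by simp)
  rw [one_mul, one_mul] at hlim
  refine ge_of_tendsto hlim ?_
  filter_upwards [self_mem_nhdsWithin] with ε hε
  rw [mul_assoc]
  exact h1 ε hε

/-- The Itô isometry. -/
lemma IsStochasticIntegral.isometry [Countable ι] (hW : IsCylindricalWiener P F W)
    {b : HilbertBasis ι ℝ H} {Φ : ℝ → H → U} {X : Ω → U}
    (hX : IsStochasticIntegral b P W Φ X) :
    ∫⁻ ω, ‖X ω‖ₑ ^ 2 ∂P = ∫⁻ s in Set.Icc 0 T, hsNormSq b (Φ s) := by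
  obtain ⟨hΦ, hXm, Ψ, h1, h2⟩ := hX
  have hcomm : ∀ n s, hsNormSq b (fun v => Φ s v - (Ψ n).eval s v)
      = hsNormSq b (fun v => (Ψ n).eval s v - Φ s v) := fun n s => by
    simp only [hsNormSq]
    exact tsum_congr fun i => by rw [enorm_sub_rev]
  -- The pivot `a n` is the common value of both sides for `Ψ n`; each side differs from it by an
  -- error controlled by `h1` or `h2`.
  refine le_antisymm (le_of_approx h2 h1 (a := fun n => ∫⁻ ω, ‖(Ψ n).integral W ω‖ₑ ^ 2 ∂P)
    (fun ε hε n => ?_) fun ε hε n => ?_) (le_of_approx h1 h2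
      (a := fun n => ∫⁻ ω, ‖(Ψ n).integral W ω‖ₑ ^ 2 ∂P) (fun ε hε n => ?_) fun ε hε n => ?_)
  · simp_rw [enorm_sub_rev ((Ψ n).integral W _)]
    exact lintegral_enorm_sq_le_add ((Ψ n).aestronglyMeasurable_integral hW) hε
  · rw [(Ψ n).isometry hW b]
    exact lintegral_hsNormSq_le_add b hΦ hε
  · rw [(Ψ n).isometry hW b]
    simp_rw [← hcomm]
    exact lintegral_hsNormSq_le_add b (fun v => (Ψ n).aestronglyMeasurable_eval v _) hε
  · exact lintegral_enorm_sq_le_add hXm hε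

end Isometry

/-! ### Action of the wave semigroup on single modes -/

section Modes

variable {ι : Type*} {H : Type*} [NormedAddCommGroup H] [InnerProductSpace ℝ H]
  {E : Type*} [NormedAddCommGroup E] [InnerProductSpace ℝ E]
  {b : HilbertBasis ι ℝ H} {lam mu : ι → ℝ} {j : H →ₗ[ℝ] E}

lemma inner_basis_ne (b : HilbertBasis ι ℝ H) {i k : ι} (h : k ≠ i) : ⟪b k, b i⟫_ℝ = 0 :=
  b.orthonormal.inner_eq_zero h

lemma inner_basis_self (b : HilbertBasis ι ℝ H) (i : ι) : ⟪b i, b i⟫_ℝ = 1 := by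
  rw [real_inner_self_eq_norm_sq, b.orthonormal.norm_eq_one, one_pow]

namespace IsInterpolationSpace

lemma norm_basis_sq {r : ℝ} (hj : IsInterpolationSpace b lam r j) (i : ι) :
    ‖j (b i)‖ ^ 2 = (|lam i| ^ r) ^ 2 := by
  have h := (hj.norm_sq (b i)).unique (hasSum_single i fun k hk => by
    rw [inner_basis_ne b hk, mul_zero, zero_pow two_ne_zero])
  rwa [inner_basis_self, mul_one] at h

/-- Every index sees at most one of `b i`, `b k`, so the squared norm is additive on `b i + b k` and
the cross term vanishes. -/
lemma inner_basis {r : ℝ} (hj : IsInterpolationSpace b lam r j) {i k : ι} (h : i ≠ k) :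
    ⟪j (b i), j (b k)⟫_ℝ = 0 := by
  have h1 : HasSum (fun m => (|lam m| ^ r * ⟪b m, b i + b k⟫_ℝ) ^ 2)
      (‖j (b i)‖ ^ 2 + ‖j (b k)‖ ^ 2) := by
    refine ((hj.norm_sq (b i)).add (hj.norm_sq (b k))).congr_fun fun m => ?_
    rw [inner_add_right]
    by_cases hm : m = i
    · rw [inner_basis_ne b (by rw [hm]; exact h : m ≠ k)]
      ring
    · rw [inner_basis_ne b hm]
      ring
  have h2 := (hj.norm_sq (b i + b k)).unique h1
  rw [map_add, norm_add_sq_real] at h2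
  linarith

lemma norm_basis_sq_neg_half (hj : IsInterpolationSpace b lam (-1 / 2) j) (i : ι) :
    ‖j (b i)‖ ^ 2 = |lam i|⁻¹ := by
  rw [hj.norm_basis_sq, ← Real.rpow_natCast, ← Real.rpow_mul (abs_nonneg _)]
  norm_num [Real.rpow_neg_one]

end IsInterpolationSpace

lemma noiseOperator_basis (i : ι) :
    noiseOperator b mu j (b i) = WithLp.toLp 2 (0, mu i • j (b i)) := by
  rw [noiseOperator, tsum_eq_single i fun k hk => by rw [inner_basis_ne b hk, mul_zero, zero_smul],
    inner_basis_self, mul_one]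

lemma proj_zero (f : ι → E) (I : Set ι) : proj f I 0 = 0 := by
  simp [proj]

open Classical in
-- The vectors `|lam k| ^ (1 / 2) • j (b k)` are orthonormal in `E`, so the projection fixes `j (b
-- i)` or kills it.
lemma phaseProj_noiseOperator_basis (hj : IsInterpolationSpace b lam (-1 / 2) j)
    (hlam : ∀ i, lam i ≠ 0) (I : Set ι) (i : ι) :
    phaseProj b lam j I (noiseOperator b mu j (b i))
      = if i ∈ I then mu i • WithLp.toLp 2 (0, j (b i)) else 0 := by
  have hz : ∀ k, k ≠ i → ⟪(|lam k| ^ (1 / 2 : ℝ)) • j (b k), mu i • j (b i)⟫_ℝ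
      • (|lam k| ^ (1 / 2 : ℝ)) • j (b k) = 0 := by
    intro k hk
    rw [real_inner_smul_left, real_inner_smul_right, hj.inner_basis hk, mul_zero, mul_zero,
      zero_smul]
  have hself : ⟪(|lam i| ^ (1 / 2 : ℝ)) • j (b i), mu i • j (b i)⟫_ℝ
      • (|lam i| ^ (1 / 2 : ℝ)) • j (b i) = mu i • j (b i) := by
    rw [real_inner_smul_left, real_inner_smul_right, real_inner_self_eq_norm_sq,
      hj.norm_basis_sq_neg_half, smul_smul]
    congr 1
    rw [← Real.sqrt_eq_rpow]
    have h1 : √|lam i| * √|lam i| = |lam i| := Real.mul_self_sqrt (abs_nonneg _)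
    have h2 : |lam i| ≠ 0 := abs_ne_zero.2 (hlam i)
    field_simp
    rw [sq, h1, mul_comm]
  rw [noiseOperator_basis, phaseProj]
  change WithLp.toLp 2 (proj b I 0, proj _ I (mu i • j (b i))) = _
  rw [proj_zero]
  split_ifs with hi
  · have h3 : proj (fun i => (|lam i| ^ (1 / 2 : ℝ)) • j (b i)) I (mu i • j (b i))
        = mu i • j (b i) := by
      rw [proj, tsum_eq_single (⟨i, hi⟩ : I) fun k hk => hz k fun h => hk (Subtype.ext h)]
      exact hself
    rw [h3, ← WithLp.toLp_smul, Prod.smul_mk, smul_zero]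
  · have h3 : proj (fun i => (|lam i| ^ (1 / 2 : ℝ)) • j (b i)) I (mu i • j (b i)) = 0 := by
      rw [proj]
      refine (tsum_congr fun k : I => hz k fun h => hi (h ▸ k.2)).trans tsum_zero
    rw [h3]
    rfl

/-- Together with `waveOperator_snd`, this supplies the hypotheses of `apply_oscillator` on the
plane of mode `i`. -/
lemma waveOperator_fst {κ : ℝ} {i : ι} (h : lam i = -κ ^ 2) :
    WaveOperator b lam j (WithLp.toLp 2 (b i, 0)) (-κ ^ 2 • WithLp.toLp 2 (0, j (b i))) := by
  refine ⟨?_, by simp, ?_⟩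
  · refine (hasSum_single i fun k hk => ?_).summable
    change |lam k| * ⟪b k, b i⟫_ℝ ^ 2 = 0
    rw [inner_basis_ne b hk]
    ring
  · have h1 : HasSum (fun k => (lam k * ⟪b k, b i⟫_ℝ) • j (b k)) ((lam i * ⟪b i, b i⟫_ℝ) • j (b i)) :=
      hasSum_single i fun k hk => by rw [inner_basis_ne b hk, mul_zero, zero_smul]
    rwa [inner_basis_self, mul_one, h] at h1

lemma waveOperator_snd (i : ι) :
    WaveOperator b lam j (WithLp.toLp 2 (0, j (b i))) (WithLp.toLp 2 (b i, 0)) := by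
  refine ⟨?_, rfl, ?_⟩
  · simp
  · simp

/-- The wave group acts isometrically on the mode `(0, b i)`. -/
lemma norm_semigroup_mode_sq [CompleteSpace H] [CompleteSpace E]
    {S : ℝ → Phase H E →L[ℝ] Phase H E} (hS : IsSemigroupGeneratedBy S (WaveOperator b lam j))
    (hj : IsInterpolationSpace b lam (-1 / 2) j) {i : ι} (hlam : lam i < 0) {t : ℝ} (ht : 0 ≤ t) :
    ‖S t (WithLp.toLp 2 (0, j (b i)))‖ ^ 2 = |lam i|⁻¹ := by
  have hpos : 0 < |lam i| := abs_pos.2 hlam.ne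
  have hsq : √|lam i| ^ 2 = |lam i| := Real.sq_sqrt hpos.le
  rw [hS.apply_oscillator (Real.sqrt_pos.2 hpos)
    (waveOperator_fst (by rw [hsq, abs_of_neg hlam, neg_neg])) (waveOperator_snd i) ht,
    WithLp.prod_norm_sq_eq_of_L2]
  have h1 : ‖b i‖ = 1 := b.orthonormal.norm_eq_one i
  -- The components contribute `sin² / |lam i|` and `cos² * |lam i|⁻¹`: the norm of `H_{-1/2}`
  -- balances the two energies.
  change ‖(Real.sin (√|lam i| * t) / √|lam i|) • b i + Real.cos (√|lam i| * t) • (0 : H)‖ ^ 2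
    + ‖(Real.sin (√|lam i| * t) / √|lam i|) • (0 : E) + Real.cos (√|lam i| * t) • j (b i)‖ ^ 2 = _
  simp only [smul_zero, add_zero, zero_add, norm_smul, mul_pow, h1, hj.norm_basis_sq_neg_half,
    Real.norm_eq_abs, sq_abs, div_pow, hsq]
  have h2 := Real.sin_sq_add_cos_sq (√|lam i| * t)
  field_simp
  linarith

open Classical in
-- The value does not depend on `t`, so the time integral in the isometry only contributes a factor
-- `T`.
lemma hsNormSq_wave [CompleteSpace H] [CompleteSpace E]
    {S : ℝ → Phase H E →L[ℝ] Phase H E} (hS : IsSemigroupGeneratedBy S (WaveOperator b lam j))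
    (hj : IsInterpolationSpace b lam (-1 / 2) j) (hlam : ∀ i, lam i < 0) (I : Set ι) {t : ℝ}
    (ht : 0 ≤ t) :
    hsNormSq b (fun v => S t (phaseProj b lam j I (noiseOperator b mu j v)))
      = ∑' i, ENNReal.ofReal (if i ∈ I then mu i ^ 2 * |lam i|⁻¹ else 0) := by
  refine tsum_congr fun i => ?_
  beta_reduce
  rw [phaseProj_noiseOperator_basis hj (fun i => (hlam i).ne), enorm_sq_eq_ofReal]
  congr 1
  split_ifs
  · rw [map_smul, norm_smul, mul_pow, norm_semigroup_mode_sq hS hj (hlam i) ht, Real.norm_eq_abs,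
      sq_abs]
  · simp

end Modes

end StochWave

/-! ### Second moments and the truncation error -/

theorem corollary2p7
    {H : Type*} [NormedAddCommGroup H] [InnerProductSpace ℝ H] [CompleteSpace H]
    {ι : Type*} (b : HilbertBasis ι ℝ H)
    {Ω : Type*} {mΩ : MeasurableSpace Ω} (P : Measure Ω) [IsProbabilityMeasure P]
    (T : ℝ) (hT : 0 < T)
    (F : Filtration (Set.Icc (0 : ℝ) T) mΩ) (hF : IsNormalFiltration P F)
    (W : Set.Icc (0 : ℝ) T → H → Ω → ℝ) (hW : IsCylindricalWiener P F W)
    -- the eigenvalues of `A`, with their enumeration, and the coefficients of the noise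
    (c p δ : ℝ) (hc : 0 < c) (hp : 0 < p) (hδ : δ < 1 / 2 - 1 / (2 * p))
    (lam : ι → ℝ) (e : ℕ+ ≃ ι) (hlam : ∀ n : ℕ+, lam (e n) = -c * (n : ℝ) ^ p)
    (mu : ι → ℝ) (hmu : ∀ i, |mu i| = |lam i| ^ δ)
    -- the interpolation space `H_{-1/2}`
    {E : Type*} [NormedAddCommGroup E] [InnerProductSpace ℝ E] [CompleteSpace E]
    (j : H →ₗ[ℝ] E) (hj : IsInterpolationSpace b lam (-1 / 2) j)
    -- the semigroup `e^{t𝐀}`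
    (S : ℝ → Phase H E →L[ℝ] Phase H E)
    (hS : IsSemigroupGeneratedBy S (WaveOperator b lam j))
    -- `𝐗^I = ∫_0^T e^{(T-s)𝐀} 𝐏_I 𝐁 dW_s`
    (X : Set ι → Ω → Phase H E)
    (hX : ∀ I : Set ι, IsStochasticIntegral b P W
      (fun s v => S (T - s) (phaseProj b lam j I (noiseOperator b mu j v))) (X I))
    (N : ℕ+) :
    MemLp (X Set.univ) 2 P ∧ MemLp (X (e '' Set.Iic N)) 2 P ∧
    (∫ ω, ‖X Set.univ ω‖ ^ 2 ∂P) - (∫ ω, ‖X (e '' Set.Iic N) ω‖ ^ 2 ∂P)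
      ≥ T * c ^ (2 * δ - 1) * (N : ℝ) ^ (p * (2 * δ - 1) + 1)
        / ((p * (1 - 2 * δ) - 1) * 2 ^ (p * (1 - 2 * δ) - 1)) := by
  classical
  have : Countable ι := Countable.of_equiv _ e
  set q : ℝ := p * (1 - 2 * δ) with hqdef
  -- This is `hδ` multiplied by `p`: it says exactly that the series of variances converges.
  have hq : 1 < q := by
    have h1 : p * (1 / (2 * p)) = 1 / 2 := by field_simp
    nlinarith [mul_lt_mul_of_pos_left hδ hp]
  have hnpos : ∀ n : ℕ+, (0 : ℝ) < n := fun n => by exact_mod_cast n.pos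
  have hneg : ∀ i, lam i < 0 := fun i => by
    obtain ⟨n, rfl⟩ := e.surjective i
    rw [hlam, neg_mul]
    exact neg_neg_of_pos (mul_pos hc (Real.rpow_pos_of_pos (hnpos n) p))
  -- the variance of a single mode
  have hmode : ∀ n : ℕ+, mu (e n) ^ 2 * |lam (e n)|⁻¹ = c ^ (2 * δ - 1) * ((n : ℕ) : ℝ) ^ (-q) := by
    intro n
    have hl : |lam (e n)| = c * (n : ℝ) ^ p := by
      rw [abs_of_neg (hneg _), hlam]; ring
    have hlpos : 0 < |lam (e n)| := abs_pos.2 (hneg _).ne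
    rw [← sq_abs, hmu, ← Real.rpow_neg_one |lam (e n)|, ← Real.rpow_natCast (|lam (e n)| ^ δ),
      ← Real.rpow_mul hlpos.le, ← Real.rpow_add hlpos, hl,
      Real.mul_rpow hc.le (Real.rpow_nonneg (hnpos n).le _), ← Real.rpow_mul (hnpos n).le]
    congr 2 <;> push_cast
    · ring
    · rw [hqdef]; ring
  set v : ℕ+ → ℝ := fun n => c ^ (2 * δ - 1) * ((n : ℕ) : ℝ) ^ (-q) with hv
  have hv0 : ∀ n, 0 ≤ v n := fun n => by positivity
  have hvs : Summable v :=
    ((Real.summable_nat_rpow.2 (by linarith : -q < -1)).comp_injective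
      PNat.coe_injective).mul_left _
  have hvI : ∀ I : Set ℕ+, Summable (I.indicator v) := fun I => hvs.indicator I
  -- the second moments
  have hmom : ∀ I : Set ℕ+, ∫⁻ ω, ‖X (e '' I) ω‖ₑ ^ 2 ∂P
      = ENNReal.ofReal (T * ∑' n, I.indicator v n) := by
    intro I
    rw [(hX (e '' I)).isometry hW]
    have h1 : ∀ s ∈ Set.Icc 0 T, hsNormSq b
        (fun v => S (T - s) (phaseProj b lam j (e '' I) (noiseOperator b mu j v)))
        = ENNReal.ofReal (∑' n, I.indicator v n) := by
      intro s hs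
      rw [hsNormSq_wave hS hj hneg _ (sub_nonneg.2 hs.2), ← e.tsum_eq,
        ENNReal.ofReal_tsum_of_nonneg (fun n => Set.indicator_nonneg (fun n _ => hv0 n) n) (hvI I)]
      refine tsum_congr fun n => ?_
      simp only [e.injective.mem_set_image, hmode, Set.indicator_apply, hv]
    rw [setLIntegral_congr_fun measurableSet_Icc h1, setLIntegral_const, Real.volume_Icc, sub_zero,
      mul_comm, ENNReal.ofReal_mul hT.le]
  have hmem : ∀ I : Set ℕ+, MemLp (X (e '' I)) 2 P ∧
      ∫ ω, ‖X (e '' I) ω‖ ^ 2 ∂P = T * ∑' n, I.indicator v n := by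
    intro I
    have hm := (hX (e '' I)).2.1
    constructor
    · refine ⟨hm, ?_⟩
      rw [eLpNorm_lt_top_iff_lintegral_rpow_enorm_lt_top two_ne_zero ENNReal.ofNat_ne_top]
      have h2 := hmom I
      simp only [ENNReal.toReal_ofNat, ENNReal.rpow_ofNat]
      rw [h2]
      exact ENNReal.ofReal_lt_top
    · rw [integral_eq_lintegral_of_nonneg_ae (.of_forall fun _ => sq_nonneg _) (hm.norm.pow 2)]
      simp_rw [← enorm_sq_eq_ofReal]
      rw [hmom I, ENNReal.toReal_ofReal]
      exact mul_nonneg hT.le (tsum_nonneg fun n => Set.indicator_nonneg (fun n _ => hv0 n) n)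
  -- Puts both index sets in the form `e '' I` treated by `hmem`.
  have huniv : (Set.univ : Set ι) = e '' Set.univ := by
    rw [Set.image_univ, e.surjective.range_eq]
  rw [huniv]
  refine ⟨(hmem _).1, (hmem _).1, ?_⟩
  rw [(hmem _).2, (hmem _).2, ← mul_sub, ← (hvI _).tsum_sub (hvI _), ge_iff_le]
  have htail : ∑' n, (Set.univ.indicator v n - (Set.Iic N).indicator v n)
      = c ^ (2 * δ - 1) * ∑' k : ℕ, (((N : ℕ) + 1 + k : ℕ) : ℝ) ^ (-q) := by
    rw [← tsum_mul_left]
    -- `φ` enumerates the indices `n > N`, outside of which the two indicators cancel.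
    let φ : ℕ → ℕ+ := fun k => ⟨N + 1 + k, by positivity⟩
    have hφ : Function.Injective φ := fun k l h => by
      have := congrArg PNat.val h
      simp only [φ, PNat.mk_coe] at this
      omega
    have hsupp : Function.support (fun n => Set.univ.indicator v n - (Set.Iic N).indicator v n)
        ⊆ Set.range φ := by
      intro n hn
      have hnN : ¬ n ≤ N := fun h => hn (by simp [h])
      have hlt : (N : ℕ) < n := not_le.1 hnN
      refine ⟨n - (N + 1), PNat.eq ?_⟩
      simp only [φ, PNat.mk_coe]
      omega
    rw [← hφ.tsum_eq hsupp]
    refine tsum_congr fun k => ?_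
    have hnot : ¬ φ k ≤ N := by
      rw [← PNat.coe_le_coe]
      simp only [φ, PNat.mk_coe]
      omega
    rw [Set.indicator_of_mem (Set.mem_univ _), Set.indicator_of_notMem (by exact hnot), sub_zero]
    rfl
  rw [htail]
  have hfin := rpow_le_tsum_tail hq N.pos
  have hexp : p * (2 * δ - 1) + 1 = 1 - q := by rw [hqdef]; ring
  rw [hexp, mul_assoc, mul_div_assoc, mul_div_assoc]
  gcongr
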